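/- Let $K/F$ be a finite cyclic Galois field extension with Galois group generated by $\sigma$, and let $R=K[t;\sigma]$ be the twisted polynomial ring of polynomials $\sum_i a_it^i$ ($a_i\in K$), with multiplication determined by $ta=\sigma(a)t$ for all $a\in K$. A \emph{bound} of $f\in R$ is a nonzero $f^*\in R$ such that $Rf^*$ is the largest two-sided ideal of $R$ contained in $Rf$. Two nonzero elements $f,g\in R$ are \emph{similar} if $R/Rf\cong R/Rg$ as left $R$-modules. An element of $R$ is \emph{irreducible} if it is not a unit and is not a product of two non-units. Let $f,g\in R$ be irreducible of the same degree $m$. Then $f$ and $g$ have bounds, and for any bounds $f^*$ of $f$ and $g^*$ of $g$, the polynomials $f$ and $g$ are similar if and only if $f^*$ and $g^*$ are the same up to a nonzero scalar, i.e. $f^*=ag^*$ for some $a\in K^\times$. -/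

import Mathlib

noncomputable section

/-- The action of the additive monoid `ℕ` on `K` in which `i` acts as `σ ^ i`. -/
@[reducible]
def sigmaAction {F K : Type*} [Field F] [Field K] [Algebra F K] (σ : K ≃ₐ[F] K) :
    MulSemiringAction (Multiplicative ℕ) K :=
  MulSemiringAction.compHom K (powersHom (K ≃ₐ[F] K) σ)

/-- The twisted polynomial ring `K[t;σ]`: finite sums `∑ aᵢ tⁱ` with coefficients on the left and
`t * a = σ a * t`. It is Mathlib's `SkewPolynomial K` for the action of `ℕ` by powers of `σ`. -/
def TwistedPolynomial {F K : Type*} [Field F] [Field K] [Algebra F K] (_σ : K ≃ₐ[F] K) :=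
  SkewPolynomial K

namespace TwistedPolynomial

variable {F K : Type*} [Field F] [Field K] [Algebra F K] {σ : K ≃ₐ[F] K}

instance : Ring (TwistedPolynomial σ) :=
  @SkewPolynomial.instRing K _ (sigmaAction σ)

/-- The constant polynomials, as a ring homomorphism `K → K[t;σ]`. -/
def C (σ : K ≃ₐ[F] K) : K →+* TwistedPolynomial σ :=
  @SkewPolynomial.CRingHom K _ (sigmaAction σ)

/-- The variable `t`. -/
def t (σ : K ≃ₐ[F] K) : TwistedPolynomial σ :=
  (SkewPolynomial.X : SkewPolynomial K)

theorem t_mul_C (a : K) : t σ * C σ a = C σ (σ a) * t σ := by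
  letI := sigmaAction σ
  have h : (SkewPolynomial.X : SkewPolynomial K) * SkewPolynomial.C a =
      SkewPolynomial.C (σ a) * SkewPolynomial.X := by
    rw [← SkewPolynomial.monomial_one_one_eq_X, SkewPolynomial.monomial_mul_C,
      SkewPolynomial.C_mul_monomial]
    simp only [Function.iterate_one, mul_one, one_mul]
    rfl
  exact h

/-- The degree in `t`, with `degree 0 = ⊥`. -/
def degree (f : TwistedPolynomial σ) : WithBot ℕ :=
  (SkewPolynomial.support (f : SkewPolynomial K)).max

end TwistedPolynomial

/-- `b` is a bound of `f`: it is nonzero and `R b` is the largest two-sided ideal of `R`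
contained in `R f`. (For a ring `R`, `Ideal R` is the type of left ideals, so that
`Ideal.span {f}` is `R f`.) -/
def IsBound {R : Type*} [Ring R] (f b : R) : Prop :=
  b ≠ 0 ∧ (Ideal.span {b}).IsTwoSided ∧ Ideal.span {b} ≤ Ideal.span {f} ∧
    ∀ I : Ideal R, I.IsTwoSided → I ≤ Ideal.span {f} → I ≤ Ideal.span {b}

/-- `f` and `g` are similar: `R / R f` and `R / R g` are isomorphic as left `R`-modules. -/
def AreSimilar {R : Type*} [Ring R] (f g : R) : Prop :=
  Nonempty ((R ⧸ Ideal.span {f}) ≃ₗ[R] (R ⧸ Ideal.span {g}))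

end

/-! A bound of `f` is a generator of the annihilator of M = R/Rf, so similar elements have bounds
generating the same left ideal. Since σ fixes F, F is central in R, and division with remainder
makes M finite-dimensional over F. As R is not, the annihilator is nonzero; R being a left principal
ideal ring, a bound exists. For the converse, M is simple when `f` is irreducible, and R/Ann M
embeds in a finite power of M. A simple module killed by Ann M is a quotient of R/Ann M, hence
isomorphic to M (`nonempty_linearEquiv_of_annihilator_le`). Units of R are nonzero constants, so
equal ideals mean bounds equal up to a scalar. -/

theorem IsBound.span_eq_annihilator {R : Type*} [Ring R] {f b : R} (h : IsBound f b) :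
    Ideal.span {b} = Module.annihilator R (R ⧸ Ideal.span {f}) := by
  obtain ⟨-, h2, hle, hmax⟩ := h
  apply le_antisymm
  · intro r hr
    rw [Module.mem_annihilator]
    intro x
    obtain ⟨y, rfl⟩ := Submodule.Quotient.mk_surjective _ x
    rw [← Submodule.Quotient.mk_smul, Submodule.Quotient.mk_eq_zero]
    exact hle (h2.mul_mem_of_left y hr)
  · refine hmax _ inferInstance fun r hr ↦ ?_
    rw [Module.mem_annihilator] at hr
    simpa [← Submodule.Quotient.mk_smul, Submodule.Quotient.mk_eq_zero] using
      hr (Submodule.Quotient.mk 1)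

theorem isBound_of_span_eq_annihilator {R : Type*} [Ring R] {f b : R} (hb : b ≠ 0)
    (h : Ideal.span {b} = Module.annihilator R (R ⧸ Ideal.span {f})) : IsBound f b := by
  refine ⟨hb, h ▸ inferInstance, ?_, ?_⟩
  · rw [h]
    intro r hr
    rw [Module.mem_annihilator] at hr
    simpa [← Submodule.Quotient.mk_smul, Submodule.Quotient.mk_eq_zero] using
      hr (Submodule.Quotient.mk 1)
  · rw [h]
    intro I hI hle r hr
    rw [Module.mem_annihilator]
    intro x
    obtain ⟨y, rfl⟩ := Submodule.Quotient.mk_surjective _ x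
    rw [← Submodule.Quotient.mk_smul, Submodule.Quotient.mk_eq_zero]
    exact hle (hI.mul_mem_of_left y hr)

/-! ### Modules finite over a central field -/

/-- A module which is finite over a central field has its annihilator cut out by finitely many
elements. -/
theorem exists_fin_ker_pi_toSpanSingleton_eq_annihilator (F : Type*) {R M : Type*} [Field F] [Ring R] [Algebra F R]
    [AddCommGroup M] [Module F M] [Module R M] [IsScalarTower F R M] [Module.Finite F M] :
    ∃ (n : ℕ) (x : Fin n → M),
      LinearMap.ker (LinearMap.pi fun i ↦ LinearMap.toSpanSingleton R M (x i)) =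
        Module.annihilator R M := by
  obtain ⟨n, x, hx⟩ := Module.Finite.exists_fin (R := F) (M := M)
  refine ⟨n, x, le_antisymm (fun r hr ↦ ?_) fun r hr ↦ ?_⟩
  · have hr' : ∀ i, r • x i = 0 := fun i ↦ congrFun (LinearMap.mem_ker.1 hr) i
    have := IsScalarTower.to_smulCommClass (R := F) (A := R) (M := M)
    rw [Module.mem_annihilator]
    intro m
    have hm : m ∈ Submodule.span F (Set.range x) := hx ▸ Submodule.mem_top
    induction hm using Submodule.span_induction with
    | mem y hy => obtain ⟨i, rfl⟩ := hy; exact hr' i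
    | zero => simp
    | add y z _ _ hy hz => rw [smul_add, hy, hz, add_zero]
    | smul c y _ hy => rw [smul_comm c r y |>.symm, hy, smul_zero]
  · rw [Module.mem_annihilator] at hr
    exact LinearMap.mem_ker.2 (funext fun i ↦ hr (x i))

/-- A zero annihilator would embed R, F-linearly, in a finite power of M. -/
theorem annihilator_ne_bot_of_finite (F : Type*) {R M : Type*} [Field F] [Ring R] [Algebra F R]
    [AddCommGroup M] [Module F M] [Module R M] [IsScalarTower F R M] [Module.Finite F M]
    (hR : ¬ Module.Finite F R) :
    Module.annihilator R M ≠ ⊥ := by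
  intro h
  obtain ⟨n, x, hx⟩ := exists_fin_ker_pi_toSpanSingleton_eq_annihilator F (R := R) (M := M)
  rw [h, LinearMap.ker_eq_bot] at hx
  exact hR (Module.Finite.of_injective
    ((LinearMap.pi fun i ↦ LinearMap.toSpanSingleton R M (x i)).restrictScalars F) hx)

theorem nonempty_linearEquiv_of_annihilator_le (F : Type*) {R M : Type*} [Field F] [Ring R] [Algebra F R]
    [AddCommGroup M] [Module F M] [Module R M] [IsScalarTower F R M] [Module.Finite F M]
    {N : Type*} [AddCommGroup N] [Module R N]
    [IsSimpleModule R M] [IsSimpleModule R N]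
    (h : Module.annihilator R M ≤ Module.annihilator R N) : Nonempty (M ≃ₗ[R] N) := by
  obtain ⟨n, x, hx⟩ := exists_fin_ker_pi_toSpanSingleton_eq_annihilator F (R := R) (M := M)
  set Φ := LinearMap.pi fun i ↦ LinearMap.toSpanSingleton R M (x i)
  have := IsSimpleModule.nontrivial R N
  obtain ⟨y, hy⟩ := exists_ne (0 : N)
  let ψ := LinearMap.toSpanSingleton R N y
  have hψ : Function.Surjective ψ := IsSimpleModule.toSpanSingleton_surjective R hy
  have hker : LinearMap.ker Φ ≤ LinearMap.ker ψ := fun r hr ↦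
    LinearMap.mem_ker.2 ((Module.mem_annihilator.1 (h (hx ▸ hr))) y)
  let π : LinearMap.range Φ →ₗ[R] N :=
    (Submodule.liftQ _ ψ hker).comp Φ.quotKerEquivRange.symm.toLinearMap
  have hπ : Function.Surjective π := by
    intro z
    obtain ⟨r, rfl⟩ := hψ z
    refine ⟨Φ.quotKerEquivRange (Submodule.Quotient.mk r), ?_⟩
    rw [LinearMap.comp_apply, LinearEquiv.coe_coe, LinearEquiv.symm_apply_apply,
      Submodule.liftQ_apply]
  -- The range of `Φ` lies in a power of M, so it is semisimple and `π` splits. By Schur, each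
  -- coordinate N → M of the section is zero or an isomorphism; they cannot all vanish.
  obtain ⟨s, hs⟩ := IsSemisimpleModule.lifting_property π hπ LinearMap.id
  by_contra hne
  have hzero : ∀ i, (LinearMap.proj i).comp ((LinearMap.range Φ).subtype.comp s) = 0 := by
    intro i
    rcases LinearMap.bijective_or_eq_zero
      ((LinearMap.proj i).comp ((LinearMap.range Φ).subtype.comp s)) with hb | h0
    · exact (hne ⟨(LinearEquiv.ofBijective _ hb).symm⟩).elim
    · exact h0
  have hsy : s y = 0 := Subtype.ext (funext fun i ↦ LinearMap.congr_fun (hzero i) y)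
  exact hy (by simpa [hsy] using (LinearMap.congr_fun hs y).symm)

/-! ### Bounds and similarity in left principal ideal rings -/

theorem isSimpleModule_quotient_span_of_irreducible {R : Type*} [Ring R] [IsDomain R]
    (hR : ∀ I : Ideal R, ∃ b, I = Ideal.span {b}) {f : R} (hf : Irreducible f) :
    IsSimpleModule R (R ⧸ Ideal.span {f}) := by
  rw [isSimpleModule_iff_isCoatom]
  refine ⟨fun h ↦ ?_, fun J hJ ↦ ?_⟩
  · obtain ⟨x, hx⟩ := Ideal.mem_span_singleton'.1 ((Ideal.eq_top_iff_one _).1 h)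
    exact hf.not_isUnit (IsUnit.of_mul_eq_one_right x hx)
  · obtain ⟨b, rfl⟩ := hR J
    obtain ⟨x, hx⟩ := Ideal.mem_span_singleton'.1 (hJ.le (Ideal.mem_span_singleton_self f))
    rcases hf.isUnit_or_isUnit hx.symm with h | h
    · obtain ⟨u, rfl⟩ := h
      refine (hJ.not_ge ?_).elim
      rw [Ideal.span_singleton_le_iff_mem, Ideal.mem_span_singleton']
      exact ⟨↑u⁻¹, by rw [← hx, Units.inv_mul_cancel_left]⟩
    · exact Ideal.eq_top_of_isUnit_mem _ (Ideal.mem_span_singleton_self b) h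

theorem finite_quotient_span_of_finite_remainders (F : Type*) {R : Type*} [Field F] [Ring R]
    [Algebra F R] {f : R} (W : Submodule F R) [Module.Finite F W]
    (hW : ∀ g, ∃ q, g - q * f ∈ W) : Module.Finite F (R ⧸ Ideal.span {f}) := by
  refine Module.Finite.of_surjective
    (((Ideal.span {f}).mkQ.restrictScalars F).comp W.subtype) fun x ↦ ?_
  obtain ⟨g, rfl⟩ := Submodule.Quotient.mk_surjective _ x
  obtain ⟨q, hq⟩ := hW g
  refine ⟨⟨g - q * f, hq⟩, (Submodule.Quotient.eq _).2 ?_⟩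
  rw [Submodule.subtype_apply, sub_sub_cancel_left]
  exact neg_mem (Ideal.mul_mem_left _ q (Ideal.mem_span_singleton_self f))

/-- An injective endomorphism of a finite-dimensional space, here right multiplication by `t`, would
be surjective. -/
theorem not_finite_of_forall_mul_ne_one (F : Type*) {R : Type*} [Field F] [Ring R] [IsDomain R]
    [Algebra F R] {t : R} (ht : t ≠ 0) (h : ∀ x, x * t ≠ 1) : ¬ Module.Finite F R := by
  intro
  have hinj : Function.Injective (LinearMap.mulRight F t) := fun x y h ↦ mul_right_cancel₀ ht h
  obtain ⟨x, hx⟩ := LinearMap.injective_iff_surjective.1 hinj 1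
  exact h x hx

theorem exists_isBound_of_finite_remainders (F : Type*) {R : Type*} [Field F] [Ring R]
    [Algebra F R] (hF : ¬ Module.Finite F R) (hR : ∀ I : Ideal R, ∃ b, I = Ideal.span {b}) {f : R}
    (W : Submodule F R) [Module.Finite F W] (hW : ∀ g, ∃ q, g - q * f ∈ W) :
    ∃ b, IsBound f b := by
  have := finite_quotient_span_of_finite_remainders F W hW
  obtain ⟨b, hb⟩ := hR (Module.annihilator R (R ⧸ Ideal.span {f}))
  refine ⟨b, isBound_of_span_eq_annihilator ?_ hb.symm⟩
  rintro rfl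
  exact annihilator_ne_bot_of_finite F hF (hb.trans (Ideal.span_singleton_eq_bot.2 rfl))

/-- Irreducible elements are similar exactly when their bounds generate the same ideal, provided that
the remainders modulo one of them can be chosen in a finite-dimensional space. -/
theorem areSimilar_iff_span_bound_eq (F : Type*) {R : Type*} [Field F] [Ring R] [IsDomain R]
    [Algebra F R] (hR : ∀ I : Ideal R, ∃ b, I = Ideal.span {b}) {f g b c : R}
    (hf : Irreducible f) (hg : Irreducible g)
    (W : Submodule F R) [Module.Finite F W] (hW : ∀ g, ∃ q, g - q * f ∈ W)
    (hb : IsBound f b) (hc : IsBound g c) :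
    AreSimilar f g ↔ Ideal.span {b} = Ideal.span {c} := by
  rw [hb.span_eq_annihilator, hc.span_eq_annihilator]
  refine ⟨fun ⟨e⟩ ↦ e.annihilator_eq, fun h ↦ ?_⟩
  have := finite_quotient_span_of_finite_remainders F W hW
  have := isSimpleModule_quotient_span_of_irreducible hR hf
  have := isSimpleModule_quotient_span_of_irreducible hR hg
  exact nonempty_linearEquiv_of_annihilator_le F h.le

/-! ### Degree, division and ideals in the twisted polynomial ring -/

namespace TwistedPolynomial

variable {F K : Type*} [Field F] [Field K] [Algebra F K] {σ : K ≃ₐ[F] K}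

/-- The coefficient of `t ^ n`. -/
noncomputable def coeff (f : TwistedPolynomial σ) (n : ℕ) : K :=
  SkewPolynomial.coeff (f : SkewPolynomial K) n

/-- The monomial `a t ^ n`. -/
noncomputable def monomial (σ : K ≃ₐ[F] K) (n : ℕ) (a : K) : TwistedPolynomial σ :=
  (SkewPolynomial.monomial n a : SkewPolynomial K)

@[ext]
theorem ext {f g : TwistedPolynomial σ} (h : ∀ n, coeff f n = coeff g n) : f = g :=
  SkewMonoidAlgebra.ext fun n ↦ h n.toAdd

@[simp]
theorem coeff_zero (n : ℕ) : coeff (0 : TwistedPolynomial σ) n = 0 := rfl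

@[simp]
theorem coeff_add (f g : TwistedPolynomial σ) (n : ℕ) :
    coeff (f + g) n = coeff f n + coeff g n :=
  SkewPolynomial.coeff_add (f : SkewPolynomial K) g n

@[simp]
theorem coeff_sub (f g : TwistedPolynomial σ) (n : ℕ) :
    coeff (f - g) n = coeff f n - coeff g n :=
  eq_sub_of_add_eq (by rw [← coeff_add, sub_add_cancel])

theorem coeff_monomial (n : ℕ) (a : K) (k : ℕ) :
    coeff (monomial σ n a) k = if n = k then a else 0 :=
  SkewPolynomial.coeff_monomial

theorem coeff_C (a : K) (k : ℕ) : coeff (C σ a) k = if k = 0 then a else 0 :=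
  SkewPolynomial.coeff_C

theorem coeff_one (k : ℕ) : coeff (1 : TwistedPolynomial σ) k = if k = 0 then 1 else 0 := by
  rw [← map_one (C σ), coeff_C]

theorem coeff_t (k : ℕ) : coeff (t σ) k = if 1 = k then 1 else 0 :=
  SkewPolynomial.coeff_X

theorem coeff_mul (f g : TwistedPolynomial σ) (n : ℕ) :
    coeff (f * g) n = ∑ p ∈ Finset.HasAntidiagonal.antidiagonal n, coeff f p.1 * (σ ^ p.1) (coeff g p.2) := by
  let := sigmaAction σ
  have h := SkewMonoidAlgebra.coeff_mul_antidiagonal_of_finset (k := K) (G := Multiplicative ℕ)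
    f g (Multiplicative.ofAdd n)
    ((Finset.HasAntidiagonal.antidiagonal n).map
      (Multiplicative.ofAdd.prodCongr Multiplicative.ofAdd).toEmbedding) (by
        intro p
        simp only [Finset.mem_map_equiv, Finset.HasAntidiagonal.mem_antidiagonal]
        rfl)
  rw [Finset.sum_map] at h
  exact h

/-- The degree in `t` as a natural number, with `natDegree 0 = 0`. -/
noncomputable def natDegree (f : TwistedPolynomial σ) : ℕ :=
  (SkewPolynomial.support (f : SkewPolynomial K)).sup id

theorem coeff_eq_zero_of_natDegree_lt {f : TwistedPolynomial σ} {k : ℕ} (h : natDegree f < k) :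
    coeff f k = 0 := by
  by_contra hk
  exact h.not_ge (Finset.le_sup (f := id) (SkewPolynomial.mem_support_iff.2 hk))

theorem coeff_natDegree_ne_zero {f : TwistedPolynomial σ} (hf : f ≠ 0) :
    coeff f (natDegree f) ≠ 0 := by
  have hne : (SkewPolynomial.support (f : SkewPolynomial K)).Nonempty :=
    Finset.nonempty_iff_ne_empty.2 fun h ↦ hf (SkewPolynomial.support_eq_empty.1 h)
  obtain ⟨n, hn, h⟩ := Finset.exists_mem_eq_sup _ hne id
  have h' : natDegree f = n := h
  rw [h']
  exact SkewPolynomial.mem_support_iff.1 hn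

theorem natDegree_lt_of_coeff_eq_zero {f : TwistedPolynomial σ} (hf : f ≠ 0) {n : ℕ}
    (h : ∀ k, n ≤ k → coeff f k = 0) : natDegree f < n :=
  not_le.1 fun hn ↦ coeff_natDegree_ne_zero hf (h _ hn)

theorem coeff_mul_add_eq_mul_of_forall {f g : TwistedPolynomial σ} {m n : ℕ}
    (hf : ∀ k, m < k → coeff f k = 0) (hg : ∀ k, n < k → coeff g k = 0) :
    coeff (f * g) (m + n) = coeff f m * (σ ^ m) (coeff g n) := by
  rw [coeff_mul]
  refine Finset.sum_eq_single_of_mem (m, n) (by simp) fun p hp hne ↦ ?_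
  rw [Finset.HasAntidiagonal.mem_antidiagonal] at hp
  rcases lt_trichotomy p.1 m with h | h | h
  · rw [hg p.2 (by omega), map_zero, mul_zero]
  · exact (hne (Prod.ext h (by simp only; omega))).elim
  · rw [hf _ h, zero_mul]

theorem coeff_mul_eq_zero_of_lt {f g : TwistedPolynomial σ} {m n l : ℕ}
    (hf : ∀ k, m < k → coeff f k = 0) (hg : ∀ k, n < k → coeff g k = 0) (hl : m + n < l) :
    coeff (f * g) l = 0 := by
  rw [coeff_mul]
  refine Finset.sum_eq_zero fun p hp ↦ ?_
  rw [Finset.HasAntidiagonal.mem_antidiagonal] at hp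
  rcases lt_or_ge m p.1 with h | h
  · rw [hf _ h, zero_mul]
  · rw [hg p.2 (by omega), map_zero, mul_zero]

theorem coeff_mul_natDegree_ne_zero {f g : TwistedPolynomial σ} (hf : f ≠ 0) (hg : g ≠ 0) :
    coeff (f * g) (natDegree f + natDegree g) ≠ 0 := by
  rw [coeff_mul_add_eq_mul_of_forall (fun _ ↦ coeff_eq_zero_of_natDegree_lt)
    fun _ ↦ coeff_eq_zero_of_natDegree_lt]
  exact mul_ne_zero (coeff_natDegree_ne_zero hf)
    ((map_ne_zero_iff _ (σ ^ natDegree f).injective).2 (coeff_natDegree_ne_zero hg))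

instance : Nontrivial (TwistedPolynomial σ) :=
  ⟨0, 1, fun h ↦ by simpa [coeff_one] using congrArg (coeff · 0) h⟩

instance : NoZeroDivisors (TwistedPolynomial σ) where
  eq_zero_or_eq_zero_of_mul_eq_zero {f g} h := by
    by_contra! hne
    exact coeff_mul_natDegree_ne_zero hne.1 hne.2 (by rw [h, coeff_zero])

instance : IsDomain (TwistedPolynomial σ) := NoZeroDivisors.to_isDomain _

theorem exists_eq_C_of_mul_eq_one {u v : TwistedPolynomial σ} (h : u * v = 1) :
    ∃ a : K, a ≠ 0 ∧ u = C σ a := by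
  have hu : u ≠ 0 := left_ne_zero_of_mul_eq_one h
  have hv : v ≠ 0 := right_ne_zero_of_mul_eq_one h
  have hd := coeff_mul_natDegree_ne_zero hu hv
  rw [h, coeff_one] at hd
  have hd0 : natDegree u = 0 := by
    by_contra hne
    exact hd (if_neg (by omega))
  refine ⟨coeff u 0, hd0 ▸ coeff_natDegree_ne_zero hu, ?_⟩
  ext k
  rw [coeff_C]
  split_ifs with hk
  · rw [hk]
  · exact coeff_eq_zero_of_natDegree_lt (by omega)

theorem exists_C_mul_eq_of_span_eq {f g : TwistedPolynomial σ} (hf : f ≠ 0)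
    (h : Ideal.span {f} = Ideal.span {g}) : ∃ a : K, a ≠ 0 ∧ f = C σ a * g := by
  obtain ⟨u, hu⟩ := Ideal.mem_span_singleton'.1 (h ▸ Ideal.mem_span_singleton_self f)
  obtain ⟨v, hv⟩ := Ideal.mem_span_singleton'.1 (h.symm ▸ Ideal.mem_span_singleton_self g)
  have huv : u * v = 1 := by
    apply mul_right_cancel₀ hf
    rw [mul_assoc, hv, hu, one_mul]
  obtain ⟨a, ha, rfl⟩ := exists_eq_C_of_mul_eq_one huv
  exact ⟨a, ha, hu.symm⟩

theorem span_C_mul {a : K} (ha : a ≠ 0) (f : TwistedPolynomial σ) :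
    Ideal.span {C σ a * f} = Ideal.span {f} := by
  apply le_antisymm <;> rw [Ideal.span_singleton_le_iff_mem, Ideal.mem_span_singleton']
  · exact ⟨_, rfl⟩
  · exact ⟨C σ a⁻¹, by rw [← mul_assoc, ← map_mul, inv_mul_cancel₀ ha, map_one, one_mul]⟩

/-- Right division with remainder. -/
theorem exists_forall_coeff_sub_mul_eq_zero {f : TwistedPolynomial σ} (hf : f ≠ 0)
    (g : TwistedPolynomial σ) : ∃ q, ∀ k, natDegree f ≤ k → coeff (g - q * f) k = 0 := by
  obtain ⟨n, hn⟩ : ∃ n, ∀ k, n ≤ k → coeff g k = 0 :=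
    ⟨natDegree g + 1, fun _ hk ↦ coeff_eq_zero_of_natDegree_lt hk⟩
  induction n generalizing g with
  | zero => exact ⟨0, fun k _ ↦ by simpa using hn k (Nat.zero_le k)⟩
  | succ n ih =>
    rcases lt_or_ge n (natDegree f) with h | h
    · exact ⟨0, fun k hk ↦ by simpa using hn k (by omega)⟩
    · obtain ⟨d, rfl⟩ := Nat.exists_eq_add_of_le' h
      have hl : (σ ^ d) (coeff f (natDegree f)) ≠ 0 :=
        (map_ne_zero_iff _ (σ ^ d).injective).2 (coeff_natDegree_ne_zero hf)
      -- Moving `t ^ d` past the leading coefficient of `f` applies `σ ^ d` to it, so `p * f`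
      -- cancels the top term of `g`.
      let p := monomial σ d
        (coeff g (d + natDegree f) / (σ ^ d) (coeff f (natDegree f)))
      have hp : ∀ k, d < k → coeff p k = 0 := fun k hk ↦ by
        rw [coeff_monomial, if_neg hk.ne]
      obtain ⟨q, hq⟩ := ih (g - p * f) fun k hk ↦ by
        rw [coeff_sub]
        rcases hk.eq_or_lt with rfl | hk
        · rw [coeff_mul_add_eq_mul_of_forall hp fun _ ↦ coeff_eq_zero_of_natDegree_lt,
            coeff_monomial, if_pos rfl, div_mul_cancel₀ _ hl, sub_self]
        · rw [hn k hk, coeff_mul_eq_zero_of_lt hp (fun _ ↦ coeff_eq_zero_of_natDegree_lt) hk,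
            sub_zero]
      exact ⟨q + p, fun k hk ↦ by
        rw [add_mul, add_comm, ← sub_sub]
        exact hq k hk⟩

/-- A nonzero element of least degree generates `I`, since remainders modulo it lie in `I`. -/
theorem exists_eq_span_singleton (I : Ideal (TwistedPolynomial σ)) :
    ∃ b, I = Ideal.span {b} := by
  by_cases hI : I = ⊥
  · exact ⟨0, by rw [hI, Ideal.span_singleton_eq_bot.2 rfl]⟩
  have hne : {b : TwistedPolynomial σ | b ∈ I ∧ b ≠ 0}.Nonempty := by
    obtain ⟨b, hb⟩ := Submodule.exists_mem_ne_zero_of_ne_bot hI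
    exact ⟨b, hb⟩
  obtain ⟨b, ⟨hbI, hb⟩, hmin⟩ := exists_minimalFor_of_wellFoundedLT _ natDegree hne
  refine ⟨b, le_antisymm (fun g hg ↦ ?_) ((Ideal.span_singleton_le_iff_mem I).2 hbI)⟩
  obtain ⟨q, hq⟩ := exists_forall_coeff_sub_mul_eq_zero hb g
  rw [Ideal.mem_span_singleton']
  refine ⟨q, (sub_eq_zero.1 ?_).symm⟩
  by_contra h
  have hlt := natDegree_lt_of_coeff_eq_zero h hq
  exact hlt.not_ge (hmin ⟨I.sub_mem hg (I.mul_mem_left q hbI), h⟩ hlt.le)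

theorem coeff_C_mul (a : K) (f : TwistedPolynomial σ) (n : ℕ) :
    coeff (C σ a * f) n = a * coeff f n := by
  rw [coeff_mul, Finset.sum_eq_single_of_mem (0, n) (by simp) fun p hp hne ↦ ?_]
  · simp [coeff_C]
  · rw [Finset.HasAntidiagonal.mem_antidiagonal] at hp
    have : p.1 ≠ 0 := fun h ↦ hne (Prod.ext h (by simp only; omega))
    rw [coeff_C, if_neg this, zero_mul]

theorem coeff_mul_C (f : TwistedPolynomial σ) (a : K) (n : ℕ) :
    coeff (f * C σ a) n = coeff f n * (σ ^ n) a := by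
  rw [coeff_mul, Finset.sum_eq_single_of_mem (n, 0) (by simp) fun p hp hne ↦ ?_]
  · simp [coeff_C]
  · rw [Finset.HasAntidiagonal.mem_antidiagonal] at hp
    have : p.2 ≠ 0 := fun h ↦ hne (Prod.ext (by simp only; omega) h)
    rw [coeff_C, if_neg this, map_zero, mul_zero]

noncomputable instance : Algebra F (TwistedPolynomial σ) :=
  RingHom.toAlgebra' ((C σ).comp (algebraMap F K)) fun c f ↦ by
    ext n
    rw [RingHom.comp_apply, coeff_C_mul, coeff_mul_C, AlgEquiv.commutes, mul_comm]

theorem coeff_smul (c : F) (f : TwistedPolynomial σ) (n : ℕ) :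
    coeff (c • f) n = c • coeff f n := by
  rw [Algebra.smul_def, Algebra.smul_def]
  exact coeff_C_mul _ _ _

variable (σ) in
/-- The `F`-subspace of polynomials of degree less than `n`. -/
noncomputable def degreeLT (n : ℕ) : Submodule F (TwistedPolynomial σ) where
  carrier := {f | ∀ k, n ≤ k → coeff f k = 0}
  zero_mem' _ _ := rfl
  add_mem' hf hg k hk := by rw [coeff_add, hf k hk, hg k hk, add_zero]
  smul_mem' c f hf k hk := by rw [coeff_smul, hf k hk, smul_zero]

instance [FiniteDimensional F K] (n : ℕ) : Module.Finite F (degreeLT σ n) := by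
  let φ : degreeLT σ n →ₗ[F] (Fin n → K) :=
    { toFun := fun f i ↦ coeff f.1 i
      map_add' := fun f g ↦ funext fun i ↦ coeff_add f.1 g.1 i
      map_smul' := fun c f ↦ funext fun i ↦ coeff_smul c f.1 i }
  refine Module.Finite.of_injective φ fun f g h ↦ Subtype.ext (ext fun k ↦ ?_)
  rcases lt_or_ge k n with hk | hk
  · exact congrFun h ⟨k, hk⟩
  · rw [f.2 k hk, g.2 k hk]

variable (σ) in
theorem not_finite : ¬ Module.Finite F (TwistedPolynomial σ) := by
  refine not_finite_of_forall_mul_ne_one F (t := t σ) (fun h ↦ ?_) fun x hx ↦ ?_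
  · simpa [coeff_t] using congrArg (coeff · 1) h
  -- Every left multiple of `t` has zero constant term.
  · have h0 := congrArg (coeff · 0) hx
    simp [coeff_mul, coeff_t, coeff_one] at h0

theorem exists_isBound [FiniteDimensional F K] {f : TwistedPolynomial σ} (hf : f ≠ 0) :
    ∃ b, IsBound f b :=
  exists_isBound_of_finite_remainders F (not_finite σ) exists_eq_span_singleton
    (degreeLT σ (natDegree f)) (exists_forall_coeff_sub_mul_eq_zero hf)

end TwistedPolynomial

theorem mainTheorem2 {F K : Type*} [Field F] [Field K] [Algebra F K] [FiniteDimensional F K]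
    [IsGalois F K] (σ : K ≃ₐ[F] K) (hσ : Subgroup.zpowers σ = ⊤) (m : ℕ)
    (f g : TwistedPolynomial σ) (hf : Irreducible f) (hg : Irreducible g)
    (hfm : f.degree = m) (hgm : g.degree = m) :
    (∃ b, IsBound f b) ∧ (∃ b, IsBound g b) ∧
      ∀ fs gs : TwistedPolynomial σ, IsBound f fs → IsBound g gs →
        (AreSimilar f g ↔ ∃ a : K, a ≠ 0 ∧ fs = TwistedPolynomial.C σ a * gs) := by
  refine ⟨TwistedPolynomial.exists_isBound hf.ne_zero, TwistedPolynomial.exists_isBound hg.ne_zero,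
    fun fs gs hfs hgs ↦ ?_⟩
  rw [areSimilar_iff_span_bound_eq F TwistedPolynomial.exists_eq_span_singleton hf hg
    (TwistedPolynomial.degreeLT σ f.natDegree)
    (TwistedPolynomial.exists_forall_coeff_sub_mul_eq_zero hf.ne_zero) hfs hgs]
  refine ⟨TwistedPolynomial.exists_C_mul_eq_of_span_eq hfs.1, ?_⟩
  rintro ⟨a, ha, rfl⟩
  exact TwistedPolynomial.span_C_mul ha gs
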